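/- **The game.** Let $V$ be a finite vertex set, let $G$ be a finite multigraph on $V$ (identified with its finite set of labelled edges), and let $R$ be a finite set of further "reserve" edges between vertices of $V$, disjoint from $G$, each $r\in R$ having a weight $w(r)\in[0,\infty)$; for $F\subseteq R$ put $w(F)=\sum_{r\in F}w(r)$. A *series* $\mathbb S$ consists of finitely many, and at least one, rounds. Set $G_1=G$, $R_1=R$. In the $k$th round Buster deletes a nonempty set $B_k\subseteq G_k$. If $(G_k-B_k)\cup R_k$ is not a connected graph on $V$, then *Buster wins* in the $k$th round, $F_k=\emptyset$, and the series ends. Otherwise Fixer chooses $F_k\subseteq R_k$ such that $(G_k-B_k)\cup F_k$ is connected; after this Buster may quit, in which case the series ends and *Fixer wins* in the $k$th round. If the series does not end, the next round starts from $G_{k+1}=(G_k-B_k)\cup F_k$ and $R_{k+1}=R_k-F_k$. (The same formulas define $G_{k+1},R_{k+1}$ after a last round.) The number of rounds is written $|\mathbb S|$; superscripts indicate the series. All series below start from the same $G$, $R$, $w$. **Strategies.** For a series $\mathbb S$ with $|\mathbb S|\ge k\geq 1$, a *Fixer strategy to continue $\mathbb S$ after the $k$th round* is a set $\phi$ of series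 such that: (1) the series consisting of the first $k$ rounds of $\mathbb S$ belongs to $\phi$; (2) if $\mathbb T\in\phi$ is won by Fixer in its $j$th round and $\emptyset\ne B\subseteq G^{\mathbb T}_{j+1}$, then exactly one series in $\phi$ consists of the $j$ rounds of $\mathbb T$ followed by one further round in which Buster deletes $B$; (3) every series in $\phi$ agrees with $\mathbb S$ in the first $k$ rounds; (4) if two series in $\phi$ both have a $j$th round and agree up to and including Buster's move of the $j$th round, then they have the same Fixer move in the $j$th round. **Comparison.** $\mathbb S$ is *Fixer-superior* to $\mathbb S'$ if Fixer wins $\mathbb S$ or Buster wins $\mathbb S'$, and $\sum_{j\le|\mathbb S|}|B^{\mathbb S}_j|\ge\sum_{j\le|\mathbb S'|}|B^{\mathbb S'}_j|$, and $\sum_{j\le|\mathbb S|}w(F^{\mathbb S}_j)\le\sum_{j\le|\mathbb S'|}w(F^{\mathbb S'}_j)$. **Optimal and greedy moves.** Let $1\le k\le|\mathbb S|$. The Fixer move $F^{\mathbb S}_k$ is *optimal* if there is a Fixer strategy $\phi$ to continue $\mathbb S$ after the $k$th round such that, for every series $\mathbb S'$ that agrees with $\mathbb S$ through Buster's move of the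 $k$th round and every Fixer strategy $\phi'$ to continue $\mathbb S'$ after the $k$th round, every $\mathbb T\in\phi$ is Fixer-superior to some $\mathbb T'\in\phi'$. The move $F^{\mathbb S}_k$ is *greedy* if $w(F^{\mathbb S}_k)\le w(F^{\mathbb S'}_k)$ for every series $\mathbb S'$ that agrees with $\mathbb S$ through Buster's move of the $k$th round; that is, Fixer reconnects the graph at the least possible cost. (If Buster wins in the $k$th round, the only move $\emptyset$ is greedy.) **Theorem 1.1.** For every series $\mathbb S$ and every $k$ with $1\le k\le|\mathbb S|$, the Fixer move $F^{\mathbb S}_k$ is greedy if and only if it is optimal. In particular, every greedy move by Fixer is optimal. -/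

import Mathlib

/-!
The Buster–Fixer game. A multigraph on the vertex set `V` is a finite set of labelled edges (labels
in `E`, so that parallel edges are distinct) together with the two endpoints of every edge label.
-/

/-- The spanning multigraph on `V` with edge set `S` is connected. -/
def EdgeConnected {V E : Type*} (ends : E → Sym2 V) (S : Finset E) : Prop :=
  (SimpleGraph.fromEdgeSet (ends '' (S : Set E))).Connected

/-- An instance of the model: a multigraph `G`, and a disjoint set `R` of reserve edges, each of
which has a nonnegative weight. -/
structure Arena (V E : Type*) where
  ends : E → Sym2 V
  G : Finset E
  R : Finset E
  disjoint_GR : Disjoint G R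
  w : E → ℝ
  w_nonneg : ∀ r ∈ R, 0 ≤ w r

/-- The situation at the beginning of a round. -/
structure Position (E : Type*) where
  G : Finset E
  R : Finset E

/-- One round: the set of edges deleted by Buster, and the set of reserve edges added by Fixer. -/
structure Round (E : Type*) where
  bust : Finset E
  fix : Finset E

/-- The position after a round. -/
def Position.next {E : Type*} [DecidableEq E] (p : Position E) (r : Round E) : Position E :=
  ⟨(p.G \ r.bust) ∪ r.fix, p.R \ r.fix⟩

namespace Arena

variable {V E : Type*} [DecidableEq E]

/-- The position reached after the given rounds. -/
def pos (A : Arena V E) (S : List (Round E)) : Position E :=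
  S.foldl Position.next ⟨A.G, A.R⟩

/-- After Buster deletes `B` in position `p`, Fixer is able to reconnect the graph. -/
def Fixable (A : Arena V E) (p : Position E) (B : Finset E) : Prop :=
  EdgeConnected A.ends ((p.G \ B) ∪ p.R)

/-- The round `r` can be played in position `p`. If Buster's move cannot be repaired, then Fixer's
move is empty by convention. -/
def Legal (A : Arena V E) (p : Position E) (r : Round E) : Prop :=
  r.bust.Nonempty ∧ r.bust ⊆ p.G ∧ r.fix ⊆ p.R ∧
    (A.Fixable p r.bust → EdgeConnected A.ends ((p.G \ r.bust) ∪ r.fix)) ∧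
    (¬ A.Fixable p r.bust → r.fix = ∅)

/-- A series: a nonempty list of legal rounds, in which Buster does not win before the last round.
(After a last round that Buster does not win, Buster quits, and Fixer wins.) -/
def IsSeries (A : Arena V E) (S : List (Round E)) : Prop :=
  S ≠ [] ∧
    (∀ (P : List (Round E)) (r : Round E) (Q : List (Round E)), S = P ++ r :: Q →
      A.Legal (A.pos P) r ∧ (Q ≠ [] → A.Fixable (A.pos P) r.bust))

/-- Buster wins the series in its last round. -/
def BusterWins (A : Arena V E) (S : List (Round E)) : Prop :=
  ∃ (P : List (Round E)) (r : Round E), S = P ++ [r] ∧ ¬ A.Fixable (A.pos P) r.bust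

/-- Buster quits after the last round of the series without having won. -/
def FixerWins (A : Arena V E) (S : List (Round E)) : Prop :=
  ∃ (P : List (Round E)) (r : Round E), S = P ++ [r] ∧ A.Fixable (A.pos P) r.bust

/-- `w(F)`, the total weight of a set of edges. -/
def weight (A : Arena V E) (F : Finset E) : ℝ := ∑ e ∈ F, A.w e

/-- The number of edges deleted by Buster during a series. -/
def totalBusted (_A : Arena V E) (S : List (Round E)) : ℕ :=
  (S.map fun r => r.bust.card).sum

/-- The amount spent by Fixer during a series. -/
def totalCost (A : Arena V E) (S : List (Round E)) : ℝ :=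
  (S.map fun r => A.weight r.fix).sum

/-- `S` is Fixer-superior to `S'`. -/
def FixerSuperior (A : Arena V E) (S S' : List (Round E)) : Prop :=
  (A.FixerWins S ∨ A.BusterWins S') ∧
    A.totalBusted S' ≤ A.totalBusted S ∧
    A.totalCost S ≤ A.totalCost S'

/-- `φ` is a Fixer strategy to continue `S` after the `k`th round. -/
structure IsFixerStrategy (A : Arena V E) (S : List (Round E)) (k : ℕ)
    (φ : Set (List (Round E))) : Prop where
  isSeries : ∀ T ∈ φ, A.IsSeries T
  /-- The first `k` rounds of `S` form a member of `φ`. -/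
  root_mem : S.take k ∈ φ
  /-- Every member won by Fixer is continued by exactly one more round for each Buster move. -/
  respond : ∀ T ∈ φ, A.FixerWins T → ∀ B ⊆ (A.pos T).G, B.Nonempty →
    ∃! U, U ∈ φ ∧ ∃ F, U = T ++ [⟨B, F⟩]
  /-- Every member is identical to `S` through the first `k` rounds. -/
  take_eq : ∀ T ∈ φ, T.take k = S.take k
  /-- Fixer's move depends only on the play so far. -/
  consistent : ∀ T ∈ φ, ∀ U ∈ φ, ∀ (P : List (Round E)) (B F F' : Finset E),
    (P ++ [⟨B, F⟩]) <+: T → (P ++ [⟨B, F'⟩]) <+: U → F = F'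

/-- `S` and `S'` have a `k`th round and are identical through Buster's move of that round; Fixer's
moves of the `k`th round are `F` and `F'` respectively. -/
def SameThroughBust (S S' : List (Round E)) (k : ℕ) (F F' : Finset E) : Prop :=
  ∃ (P : List (Round E)) (B : Finset E) (Q Q' : List (Round E)),
    P.length + 1 = k ∧ S = P ++ ⟨B, F⟩ :: Q ∧ S' = P ++ ⟨B, F'⟩ :: Q'

/-- Fixer's move in the `k`th round of `S` is optimal. -/
def IsOptimalMove (A : Arena V E) (S : List (Round E)) (k : ℕ) : Prop :=
  ∃ φ : Set (List (Round E)), A.IsFixerStrategy S k φ ∧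
    ∀ (S' : List (Round E)) (F F' : Finset E), A.IsSeries S' → SameThroughBust S S' k F F' →
      ∀ φ' : Set (List (Round E)), A.IsFixerStrategy S' k φ' →
        ∀ T ∈ φ, ∃ T' ∈ φ', A.FixerSuperior T T'

/-- Fixer's move in the `k`th round of `S` is greedy: no other legal answer to the same Buster move
is cheaper. (If Buster wins in the `k`th round, then the empty move is the only one.) -/
def IsGreedyMove (A : Arena V E) (S : List (Round E)) (k : ℕ) : Prop :=
  ∀ (S' : List (Round E)) (F F' : Finset E), A.IsSeries S' → SameThroughBust S S' k F F' →
    A.weight F ≤ A.weight F'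

end Arena

/-! The set `H` of all edges left after round `k`, current or in reserve, does not depend on Fixer's
answer. Let `w` be the weight on the reserve before round `k` and zero elsewhere. From then on,
Fixer's cost minus `w(G)`, with `G` the current graph, grows by exactly the weight that Buster
deletes. So if `D` is deleted in all, Fixer pays least when `G` is a least-weight spanning set of `H
\ D`, and exchange arguments show that greedy play preserves this (`IsGreedyPosition.next`).

Another Fixer strategy need not have bought the edges of `D`, so Buster cannot simply delete `D`
against it. In `IsFixerStrategy.exists_play` he deletes non-bridges of `D` one at a time. If every
current edge of `D` is a bridge of all that remains, a heaviest reserve edge of `D` is traded for a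
heaviest edge of a circuit that it closes with current edges (`IsTarget.exists_swap`). The trade is
no loss to Buster, because edges deleted under greedy play are not spanned by lighter survivors.
Once `D` has no reserve edge of positive weight, Buster quits or wins by deleting one bridge. If
greedy play loses, only a minimal disconnecting part of the last deletion is put into `D`, so the
rank drops by just one.

Conversely, let Buster quit right after an optimal move. A series of a rival strategy with no more
deletions must stop there too, so the costs of the two moves are compared directly. -/

/-! ### Spanning and exchange in the graphic matroid. -/

section Closure

variable {V E : Type*} {ends : E → Sym2 V}

/-- The two ends of the edge `e` are joined by a path with edges in `S`. -/
def Spans (ends : E → Sym2 V) (S : Finset E) (e : E) : Prop :=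
  ∀ u v, ends e = s(u, v) → (SimpleGraph.fromEdgeSet (ends '' (S : Set E))).Reachable u v

theorem reachable_ends_mono {S T : Finset E} (h : S ⊆ T) {u v : V}
    (huv : (SimpleGraph.fromEdgeSet (ends '' (S : Set E))).Reachable u v) :
    (SimpleGraph.fromEdgeSet (ends '' (T : Set E))).Reachable u v :=
  huv.mono (SimpleGraph.fromEdgeSet_mono (Set.image_mono (by exact_mod_cast h)))

theorem Spans.of_mem {S : Finset E} {e : E} (h : e ∈ S) : Spans ends S e := by
  intro u v huv
  by_cases huv' : u = v
  · subst huv'; exact SimpleGraph.Reachable.refl _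
  · apply SimpleGraph.Adj.reachable
    rw [SimpleGraph.fromEdgeSet_adj]
    exact ⟨⟨e, by exact_mod_cast h, huv⟩, huv'⟩

theorem Spans.mono {S T : Finset E} {e : E} (hST : S ⊆ T) (h : Spans ends S e) :
    Spans ends T e := fun u v huv => reachable_ends_mono hST (h u v huv)

theorem reachable_of_forall_spans {S T : Finset E} (hT : ∀ e ∈ T, Spans ends S e) {u v : V}
    (h : (SimpleGraph.fromEdgeSet (ends '' (T : Set E))).Reachable u v) :
    (SimpleGraph.fromEdgeSet (ends '' (S : Set E))).Reachable u v := by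
  rw [SimpleGraph.reachable_iff_reflTransGen] at h
  induction h with
  | refl => exact SimpleGraph.Reachable.refl _
  | tail _ hbc ih =>
    rw [SimpleGraph.fromEdgeSet_adj] at hbc
    obtain ⟨⟨e, he, heq⟩, _⟩ := hbc
    exact ih.trans (hT e (by exact_mod_cast he) _ _ heq)

theorem Spans.trans {S T : Finset E} {e : E} (hT : ∀ f ∈ T, Spans ends S f)
    (h : Spans ends T e) : Spans ends S e :=
  fun u v huv => reachable_of_forall_spans hT (h u v huv)

theorem reachable_insert [DecidableEq E] {S : Finset E} {f : E} {a b : V} (hf : ends f = s(a, b))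
    {u v : V} (h : (SimpleGraph.fromEdgeSet (ends '' (insert f S : Finset E))).Reachable u v) :
    (SimpleGraph.fromEdgeSet (ends '' (S : Set E))).Reachable u v ∨
      ((SimpleGraph.fromEdgeSet (ends '' (S : Set E))).Reachable u a ∧
        (SimpleGraph.fromEdgeSet (ends '' (S : Set E))).Reachable b v) ∨
      ((SimpleGraph.fromEdgeSet (ends '' (S : Set E))).Reachable u b ∧
        (SimpleGraph.fromEdgeSet (ends '' (S : Set E))).Reachable a v) := by
  rw [SimpleGraph.reachable_iff_reflTransGen] at h
  induction h with
  | refl => exact Or.inl (SimpleGraph.Reachable.refl _)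
  | @tail c d _ hbc ih =>
    rw [SimpleGraph.fromEdgeSet_adj] at hbc
    obtain ⟨⟨e, he, heq⟩, _⟩ := hbc
    rw [Finset.mem_coe, Finset.mem_insert] at he
    rcases he with rfl | he
    · rw [hf, Sym2.eq_iff] at heq
      rcases heq with ⟨rfl, rfl⟩ | ⟨rfl, rfl⟩
      · rcases ih with h | ⟨h, _⟩ | ⟨h, _⟩
        · exact Or.inr (Or.inl ⟨h, SimpleGraph.Reachable.refl _⟩)
        · exact Or.inr (Or.inl ⟨h, SimpleGraph.Reachable.refl _⟩)
        · exact Or.inl h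
      · rcases ih with h | ⟨h, _⟩ | ⟨h, _⟩
        · exact Or.inr (Or.inr ⟨h, SimpleGraph.Reachable.refl _⟩)
        · exact Or.inl h
        · exact Or.inr (Or.inr ⟨h, SimpleGraph.Reachable.refl _⟩)
    · have hcd := Spans.of_mem (ends := ends) he _ _ heq
      rcases ih with h | ⟨h, h'⟩ | ⟨h, h'⟩
      · exact Or.inl (h.trans hcd)
      · exact Or.inr (Or.inl ⟨h, h'.trans hcd⟩)
      · exact Or.inr (Or.inr ⟨h, h'.trans hcd⟩)

/-- The exchange property of the graphic matroid. -/
theorem Spans.exchange [DecidableEq E] {S : Finset E} {e f : E}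
    (h : Spans ends (insert f S) e) (hn : ¬ Spans ends S e) : Spans ends (insert e S) f := by
  unfold Spans at hn
  push Not at hn
  obtain ⟨u, v, huv, hn⟩ := hn
  intro a b hab
  have hS : S ⊆ insert e S := Finset.subset_insert _ _
  have huv' := Spans.of_mem (ends := ends) (Finset.mem_insert_self e S) u v huv
  -- A path from `u` to `v` must pass through `f`; closing it up with `e` gives a detour around `f`.
  rcases reachable_insert hab (h u v huv) with h | ⟨h, h'⟩ | ⟨h, h'⟩
  · exact absurd h hn
  · exact (reachable_ends_mono hS h).symm.trans
      (huv'.trans (reachable_ends_mono hS h').symm)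
  · exact (reachable_ends_mono hS h').trans
      (huv'.symm.trans (reachable_ends_mono hS h))

theorem EdgeConnected.spans {S : Finset E} (h : EdgeConnected ends S) (e : E) :
    Spans ends S e := fun u v _ => h.preconnected u v

theorem EdgeConnected.of_forall_spans {S T : Finset E} (h : EdgeConnected ends T)
    (hT : ∀ e ∈ T, Spans ends S e) : EdgeConnected ends S :=
  { preconnected := fun u v => reachable_of_forall_spans hT (h.preconnected u v)
    nonempty := h.nonempty }

theorem EdgeConnected.mono {S T : Finset E} (h : EdgeConnected ends S) (hST : S ⊆ T) :
    EdgeConnected ends T := h.of_forall_spans fun _ he => Spans.of_mem (hST he)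

theorem Spans.exists_not_spans {S T : Finset E} {e : E} (h : Spans ends T e)
    (hn : ¬ Spans ends S e) : ∃ f ∈ T, ¬ Spans ends S f := by
  by_contra! hc
  exact hn (Spans.trans hc h)

variable [DecidableEq E]

theorem Spans.exchange_erase {S : Finset E} {e f : E} (hf : f ∈ S)
    (h : Spans ends S e) (hn : ¬ Spans ends (S.erase f) e) :
    Spans ends (insert e (S.erase f)) f :=
  Spans.exchange (by rwa [Finset.insert_erase hf]) hn

/-- A set that spans `e` contains an inclusion-minimal one. -/
theorem Spans.exists_minimal {S : Finset E} {e : E} (h : Spans ends S e) :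
    ∃ K ⊆ S, Spans ends K e ∧ ∀ f ∈ K, ¬ Spans ends (K.erase f) e := by
  induction S using Finset.strongInduction with
  | H S ih =>
    by_cases hS : ∃ f ∈ S, Spans ends (S.erase f) e
    · obtain ⟨f, hf, hfe⟩ := hS
      obtain ⟨K, hK, hK'⟩ := ih _ (Finset.erase_ssubset hf) hfe
      exact ⟨K, hK.trans (Finset.erase_subset _ _), hK'⟩
    · push Not at hS
      exact ⟨S, Finset.Subset.refl _, h, hS⟩

/-- Replacing one element by another that is spanned in its place keeps the span. -/
theorem Spans.of_replace {F S : Finset E} {x q : E} (hS : ∀ e ∈ S, Spans ends F e)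
    (hx : Spans ends (insert q (F.erase x)) x) :
    ∀ e ∈ S, Spans ends (insert q (F.erase x)) e := by
  intro e he
  refine Spans.trans (fun f hf => ?_) (hS e he)
  by_cases hfx : f = x
  · exact hfx ▸ hx
  · exact Spans.of_mem (Finset.mem_insert_of_mem (Finset.mem_erase.2 ⟨hfx, hf⟩))

theorem Spans.of_erase {F S : Finset E} {x : E} (hS : ∀ e ∈ S, Spans ends F e)
    (hx : Spans ends (F.erase x) x) : ∀ e ∈ S, Spans ends (F.erase x) e := by
  intro e he
  refine Spans.trans (fun f hf => ?_) (hS e he)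
  by_cases hfx : f = x
  · exact hfx ▸ hx
  · exact Spans.of_mem (Finset.mem_erase.2 ⟨hfx, hf⟩)

/-! ### Least-weight spanning sets. -/

theorem sum_insert_erase_add {w : E → ℝ} {F : Finset E} {x q : E} (hx : x ∈ F) (hq : q ∉ F) :
    ∑ e ∈ insert q (F.erase x), w e = ∑ e ∈ F, w e - w x + w q := by
  rw [Finset.sum_insert (fun h => hq (Finset.mem_of_mem_erase h)), ← Finset.add_sum_erase F w hx]
  ring

/-- Cut property: an edge of positive weight in a spanning set of least weight is not spanned by
the rest of this set together with all lighter edges. -/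
theorem not_spans_of_minimal {w : E → ℝ} {G H : Finset E} (hGH : G ⊆ H)
    (hG : ∀ e ∈ H, Spans ends G e)
    (hmin : ∀ F ⊆ H, (∀ e ∈ H, Spans ends F e) → ∑ e ∈ G, w e ≤ ∑ e ∈ F, w e)
    {q : E} (hq : q ∈ G) (hpos : 0 < w q) :
    ¬ Spans ends (G.erase q ∪ H.filter fun e => w e < w q) q := by
  intro h
  -- Either `q` is redundant and dropping it saves weight, or some lighter edge can take its place.
  by_cases hq' : Spans ends (G.erase q) q
  · have h1 := hmin _ ((Finset.erase_subset q G).trans hGH) (Spans.of_erase hG hq')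
    rw [← Finset.add_sum_erase G w hq] at h1
    linarith
  · obtain ⟨x, hx, hxn⟩ := h.exists_not_spans hq'
    have hxG : x ∉ G.erase q := fun h => hxn (Spans.of_mem h)
    have hx' : x ∈ H ∧ w x < w q := by
      rcases Finset.mem_union.1 hx with hx | hx
      · exact absurd hx hxG
      · exact Finset.mem_filter.1 hx
    have hxG' : x ∉ G := fun h => hxG (Finset.mem_erase.2 ⟨by rintro rfl; exact lt_irrefl _ hx'.2, h⟩)
    have h1 := hmin (insert x (G.erase q))
      (Finset.insert_subset hx'.1 ((Finset.erase_subset q G).trans hGH))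
      (Spans.of_replace hG (Spans.exchange_erase hq (hG x hx'.1) hxn))
    rw [sum_insert_erase_add hq hxG'] at h1
    linarith [hx'.2]

/-- A spanning set of a subset of `H` can be made to contain all edges of positive weight of a
given set with the cut property, without increasing the weight. -/
theorem exists_spanning_superset {w : E → ℝ} {G H H' : Finset E} (hH : H' ⊆ H)
    (hcut : ∀ q ∈ G, 0 < w q → ¬ Spans ends (G.erase q ∪ H.filter fun e => w e < w q) q)
    {F : Finset E} (hF : F ⊆ H') (hFs : ∀ e ∈ H', Spans ends F e) :
    ∃ F' ⊆ H', (∀ e ∈ H', Spans ends F' e) ∧ ∑ e ∈ F', w e ≤ ∑ e ∈ F, w e ∧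
      ∀ q ∈ G, q ∈ H' → 0 < w q → q ∈ F' := by
  induction hn : ((G ∩ H') \ F).card using Nat.strong_induction_on generalizing F with
  | _ n ih =>
    by_cases hall : ∀ q ∈ G, q ∈ H' → 0 < w q → q ∈ F
    · exact ⟨F, hF, hFs, le_rfl, hall⟩
    · push Not at hall
      obtain ⟨q, hqG, hqH, hqpos, hqF⟩ := hall
      obtain ⟨K, hKF, hKq, hKmin⟩ := (hFs q hqH).exists_minimal
      -- The circuit that `q` closes in `F` has an edge `x` that is neither in `G` nor lighter than
      -- `q`. Replacing `x` by `q` leaves fewer edges of `G ∩ H'` missing.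
      obtain ⟨x, hxK, hxn⟩ := hKq.exists_not_spans (hcut q hqG hqpos)
      have hxF := hKF hxK
      have hxq : x ≠ q := by rintro rfl; exact hqF hxF
      have hxG : x ∉ G := fun h => hxn
        (Spans.of_mem (Finset.mem_union_left _ (Finset.mem_erase.2 ⟨hxq, h⟩)))
      have hxw : w q ≤ w x := by
        by_contra! hlt
        exact hxn (Spans.of_mem (Finset.mem_union_right _
          (Finset.mem_filter.2 ⟨hH (hF hxF), hlt⟩)))
      have hx : Spans ends (insert q (F.erase x)) x :=
        (Spans.exchange_erase hxK hKq (hKmin x hxK)).mono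
          (Finset.insert_subset_insert _ (Finset.erase_subset_erase _ hKF))
      obtain ⟨F', h1, h2, h3, h4⟩ := ih _ (by
          rw [← hn]
          apply Finset.card_lt_card
          rw [Finset.ssubset_iff_of_subset]
          · exact ⟨q, by simp [hqG, hqH, hqF], by simp⟩
          · intro y hy
            simp only [Finset.mem_sdiff, Finset.mem_inter, Finset.mem_insert, Finset.mem_erase,
              not_or, not_and] at hy ⊢
            refine ⟨hy.1, fun hyF => hy.2.2 ?_ hyF⟩
            rintro rfl
            exact hxG hy.1.1)
        (Finset.insert_subset hqH ((Finset.erase_subset _ _).trans hF))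
        (Spans.of_replace hFs hx) rfl
      refine ⟨F', h1, h2, h3.trans ?_, h4⟩
      rw [sum_insert_erase_add hxF hqF]
      linarith

/-- Only edges of positive weight contribute, so `F` may miss weightless edges of `G`. -/
theorem sum_inter_le_of_positive_subset {w : E → ℝ} (hw : ∀ e, 0 ≤ w e) {G F : Finset E}
    (h : ∀ q ∈ G, 0 < w q → q ∈ F) : ∑ e ∈ G, w e ≤ ∑ e ∈ F ∩ G, w e := by
  rw [← Finset.sum_filter_add_sum_filter_not G (fun e => 0 < w e) w]
  rw [Finset.sum_eq_zero (s := G.filter fun e => ¬ 0 < w e), add_zero]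
  · refine Finset.sum_le_sum_of_subset_of_nonneg (fun q hq => ?_) fun e _ _ => hw e
    rw [Finset.mem_filter] at hq
    exact Finset.mem_inter.2 ⟨h q hq.1 hq.2, hq.1⟩
  · intro e he
    exact le_antisymm (not_lt.1 (Finset.mem_filter.1 he).2) (hw e)

/-- Exchanging the edge `c` of `S` for an edge `d` outside, where `c` is a heaviest edge of a
circuit through `d`, lowers the weight of spanning sets by at most `w c - w d`. -/
theorem exists_spanning_of_swap {w : E → ℝ} (hw : ∀ e, 0 ≤ w e) {S K F : Finset E} {c d : E}
    (hd : d ∉ S) (hKS : K ⊆ S) (hKd : Spans ends K d) (hKc : ∀ e ∈ K, w e ≤ w c)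
    (hdc : w d ≤ w c) (hc : Spans ends (insert d (S.erase c)) c)
    (hF : F ⊆ insert d (S.erase c)) (hFs : ∀ e ∈ insert d (S.erase c), Spans ends F e) :
    ∃ F' ⊆ S, (∀ e ∈ S, Spans ends F' e) ∧ ∑ e ∈ F', w e ≤ ∑ e ∈ F, w e + w c - w d := by
  -- `F` already spans `S`, but it may use `d`, which is not in `S`; it remains to get rid of `d`.
  have hFS : ∀ e ∈ S, Spans ends F e := by
    intro e he
    by_cases hec : e = c
    · exact hec ▸ Spans.trans hFs hc
    · exact hFs e (Finset.mem_insert_of_mem (Finset.mem_erase.2 ⟨hec, he⟩))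
  have hFS' : F.erase d ⊆ S := by
    intro e he
    rw [Finset.mem_erase] at he
    rcases Finset.mem_insert.1 (hF he.2) with h | h
    · exact absurd h he.1
    · exact Finset.mem_of_mem_erase h
  by_cases hdF : d ∈ F
  · by_cases hd' : Spans ends (F.erase d) d
    · refine ⟨F.erase d, hFS', Spans.of_erase hFS hd', ?_⟩
      rw [← Finset.add_sum_erase F w hdF]
      linarith [hw d, hw c]
    · obtain ⟨x, hxK, hxn⟩ := hKd.exists_not_spans hd'
      have hxF : x ∉ F := fun h => hxn (Spans.of_mem (Finset.mem_erase.2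
        ⟨by rintro rfl; exact hd (hKS hxK), h⟩))
      refine ⟨insert x (F.erase d), Finset.insert_subset (hKS hxK) hFS', Spans.of_replace hFS
        (Spans.exchange_erase hdF (hFS x (hKS hxK)) hxn), ?_⟩
      rw [sum_insert_erase_add hdF hxF]
      linarith [hKc x hxK]
  · rw [Finset.erase_eq_of_notMem hdF] at hFS'
    exact ⟨F, hFS', hFS, by linarith⟩

end Closure
-- Targets and the exchange of a reserve edge.
section Target

variable {V E : Type*} [DecidableEq E] {ends : E → Sym2 V} {w : E → ℝ}

/-- A set `D` of edges that Buster may aim at deleting from the set `H` of all remaining edges,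
where the edges in `R` are still in reserve. -/
structure IsTarget (ends : E → Sym2 V) (w : E → ℝ) (H R D : Finset E) : Prop where
  subset : D ⊆ H
  /-- Reserve edges in `D` of positive weight are needed unless a lighter path remains. -/
  cut : ∀ d ∈ D, d ∈ R → 0 < w d → ¬ Spans ends ((H \ D).filter fun e => w e < w d) d
  /-- The deletion of `D` lowers the rank by at most one. -/
  corank : ∀ e ∈ H, ¬ Spans ends (H \ D) e → ∀ f ∈ H, Spans ends (insert e (H \ D)) f

theorem sdiff_erase_erase {H D : Finset E} {d : E} (hd : d ∈ D) :
    H.erase d \ D.erase d = H \ D := by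
  ext e
  simp only [Finset.mem_sdiff, Finset.mem_erase]
  constructor
  · rintro ⟨⟨h1, h2⟩, h3⟩
    exact ⟨h2, fun h => h3 ⟨h1, h⟩⟩
  · rintro ⟨h1, h2⟩
    exact ⟨⟨by rintro rfl; exact h2 hd, h1⟩, fun h => h2 h.2⟩

theorem IsTarget.erase {H R R' D : Finset E} (h : IsTarget ends w H R D) (hR : R' ⊆ R) {d : E}
    (hd : d ∈ D) : IsTarget ends w (H.erase d) R' (D.erase d) where
  subset := Finset.erase_subset_erase _ h.subset
  cut e he heR := by
    rw [sdiff_erase_erase hd]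
    exact h.cut e (Finset.mem_of_mem_erase he) (hR heR)
  corank e he := by
    rw [sdiff_erase_erase hd]
    exact fun hn f hf => h.corank e (Finset.mem_of_mem_erase he) hn f (Finset.mem_of_mem_erase hf)

/-- If Buster cannot delete any available edge of the target without winning, then only one such
edge is available. -/
theorem IsTarget.eq_of_bridges {G R D : Finset E} (h : IsTarget ends w (G ∪ R) R D)
    (hG : EdgeConnected ends G)
    (hbr : ∀ d ∈ D, d ∈ G → ¬ EdgeConnected ends ((G ∪ R).erase d)) {b b' : E}
    (hb : b ∈ D) (hbG : b ∈ G) (hb' : b' ∈ D) (hbG' : b' ∈ G) : b = b' := by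
  by_contra hne
  have hH : EdgeConnected ends (G ∪ R) := hG.mono Finset.subset_union_left
  -- A bridge `b` in `D` supplies all the rank missing from the survivors, so no other edge of `D`
  -- can be a bridge.
  have hbn : ¬ Spans ends ((G ∪ R) \ D) b := fun hs => by
    refine hbr b hb hbG (hH.of_forall_spans (Spans.of_erase (fun e he => Spans.of_mem he)
      (hs.mono fun e he => ?_)))
    rw [Finset.mem_sdiff] at he
    exact Finset.mem_erase.2 ⟨by rintro rfl; exact he.2 hb, he.1⟩
  refine hbr b' hb' hbG' (hH.of_forall_spans fun f hf =>
    (h.corank b (h.subset hb) hbn f hf).mono fun e he => ?_)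
  rcases Finset.mem_insert.1 he with rfl | he
  · exact Finset.mem_erase.2 ⟨hne, h.subset hb⟩
  · rw [Finset.mem_sdiff] at he
    exact Finset.mem_erase.2 ⟨by rintro rfl; exact he.2 hb', he.1⟩

/-- `G \ D` is `G` or `G` minus one bridge `b`. If removing `b` unspanned `e`, then `e` could
replace `b` in `G`, and `b` would not be a bridge. -/
theorem IsTarget.spans_of_bridges {G R D : Finset E} (h : IsTarget ends w (G ∪ R) R D)
    (hG : EdgeConnected ends G)
    (hbr : ∀ d ∈ D, d ∈ G → ¬ EdgeConnected ends ((G ∪ R).erase d)) {e : E}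
    (he : e ∈ G ∪ R) (he' : e ∈ D → e ∉ G) : Spans ends (G \ D) e := by
  have hH : EdgeConnected ends (G ∪ R) := hG.mono Finset.subset_union_left
  by_cases hDG : ∃ b ∈ D, b ∈ G
  · obtain ⟨b, hb, hbG⟩ := hDG
    have heq : G \ D = G.erase b := by
      ext x
      simp only [Finset.mem_sdiff, Finset.mem_erase]
      constructor
      · rintro ⟨h1, h2⟩
        exact ⟨by rintro rfl; exact h2 hb, h1⟩
      · rintro ⟨h1, h2⟩
        exact ⟨h2, fun hx => h1 (h.eq_of_bridges hG hbr hx h2 hb hbG)⟩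
    rw [heq]
    by_contra hn
    have hs := (Spans.exchange_erase hbG (hG.spans e) hn).mono (T := (G ∪ R).erase b)
      (Finset.insert_subset (Finset.mem_erase.2 ⟨by rintro rfl; exact he' hb hbG, he⟩)
        (Finset.erase_subset_erase _ Finset.subset_union_left))
    exact hbr b hb hbG (hH.of_forall_spans (Spans.of_erase (fun e he => Spans.of_mem he) hs))
  · push Not at hDG
    rw [Finset.sdiff_eq_self_of_disjoint (Finset.disjoint_right.2 hDG)]
    exact hG.spans e

/-- If the available edges of the target are bridges, then Buster can exchange a reserve edge of
the target for an available edge that is not a bridge, at no loss. -/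
theorem IsTarget.exists_swap (hw : ∀ e, 0 ≤ w e) {G R D : Finset E} (hGR : Disjoint G R)
    (h : IsTarget ends w (G ∪ R) R D) (hG : EdgeConnected ends G)
    (hbr : ∀ d ∈ D, d ∈ G → ¬ EdgeConnected ends ((G ∪ R).erase d))
    (hpos : ∃ d ∈ D, d ∈ R ∧ 0 < w d) :
    ∃ D' c, IsTarget ends w (G ∪ R) R D' ∧ D'.card = D.card ∧ c ∈ D' ∧ c ∈ G ∧
      EdgeConnected ends ((G ∪ R).erase c) ∧
      (EdgeConnected ends ((G ∪ R) \ D') → EdgeConnected ends ((G ∪ R) \ D)) ∧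
      ∀ F ⊆ (G ∪ R) \ D', (∀ e ∈ (G ∪ R) \ D', Spans ends F e) →
        ∃ F' ⊆ (G ∪ R) \ D, (∀ e ∈ (G ∪ R) \ D, Spans ends F' e) ∧
          ∑ e ∈ F', w e + ∑ e ∈ D, w e ≤ ∑ e ∈ F, w e + ∑ e ∈ D', w e := by
  have hH : EdgeConnected ends (G ∪ R) := hG.mono Finset.subset_union_left
  obtain ⟨d₀, hd₀, hd₀R, hd₀w⟩ := hpos
  -- The heaviest choice keeps the cut condition after the trade: the restored `d` is not lighter
  -- than any reserve edge still in the target.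
  obtain ⟨d, hdDR, hdmax⟩ := Finset.exists_max_image (D ∩ R) w
    ⟨d₀, Finset.mem_inter.2 ⟨hd₀, hd₀R⟩⟩
  obtain ⟨hdD, hdR⟩ := Finset.mem_inter.1 hdDR
  have hdw : 0 < w d := hd₀w.trans_le (hdmax d₀ (Finset.mem_inter.2 ⟨hd₀, hd₀R⟩))
  have hdG : d ∉ G := Finset.disjoint_right.1 hGR hdR
  obtain ⟨K, hKG, hKd, hKmin⟩ :=
    (h.spans_of_bridges hG hbr (h.subset hdD) fun _ => hdG).exists_minimal
  have hKS : K ⊆ (G ∪ R) \ D :=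
    hKG.trans (Finset.sdiff_subset_sdiff Finset.subset_union_left (Finset.Subset.refl _))
  -- The cut condition excludes loops: not even the empty set spans `d`.
  have hKne : K.Nonempty := by
    rw [Finset.nonempty_iff_ne_empty]
    rintro rfl
    exact h.cut d hdD hdR hdw (hKd.mono (Finset.empty_subset _))
  obtain ⟨c, hcK, hcmax⟩ := Finset.exists_max_image K w hKne
  obtain ⟨hcG, hcD⟩ := Finset.mem_sdiff.1 (hKG hcK)
  have hcd : c ≠ d := by rintro rfl; exact hdG hcG
  have hdc : w d ≤ w c := by
    by_contra! hlt
    exact h.cut d hdD hdR hdw (hKd.mono fun e he =>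
      Finset.mem_filter.2 ⟨hKS he, (hcmax e he).trans_lt hlt⟩)
  have heq : (G ∪ R) \ insert c (D.erase d) = insert d (((G ∪ R) \ D).erase c) := by
    ext e
    simp only [Finset.mem_sdiff, Finset.mem_insert, Finset.mem_erase, not_or, not_and]
    constructor
    · rintro ⟨h1, h2, h3⟩
      by_cases hed : e = d
      · exact Or.inl hed
      · exact Or.inr ⟨h2, h1, h3 hed⟩
    · rintro (rfl | ⟨h1, h2, h3⟩)
      · exact ⟨h.subset hdD, hcd.symm, fun h => absurd rfl h⟩
      · exact ⟨h2, h1, fun _ => h3⟩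
  have hcK' := Spans.exchange_erase hcK hKd (hKmin c hcK)
  have hc : Spans ends (insert d (((G ∪ R) \ D).erase c)) c :=
    hcK'.mono (Finset.insert_subset_insert _ (Finset.erase_subset_erase _ hKS))
  -- With `hold`, the survivors before and after the trade have the same span, which preserves the
  -- corank condition.
  have hnew : ∀ e ∈ (G ∪ R) \ D, Spans ends (insert d (((G ∪ R) \ D).erase c)) e :=
    Spans.of_replace (fun e he => Spans.of_mem he) hc
  have hold : ∀ e ∈ insert d (((G ∪ R) \ D).erase c), Spans ends ((G ∪ R) \ D) e := by
    intro e he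
    rcases Finset.mem_insert.1 he with rfl | he
    · exact hKd.mono hKS
    · exact Spans.of_mem (Finset.mem_of_mem_erase he)
  have hsum : ∑ e ∈ insert c (D.erase d), w e = ∑ e ∈ D, w e - w d + w c :=
    sum_insert_erase_add hdD hcD
  refine ⟨insert c (D.erase d), c, ⟨?_, ?_, ?_⟩, ?_, Finset.mem_insert_self _ _, hcG, ?_, ?_, ?_⟩
  · exact Finset.insert_subset (Finset.mem_union_left _ hcG)
      ((Finset.erase_subset _ _).trans h.subset)
  · intro e he heR hew hs
    rcases Finset.mem_insert.1 he with rfl | he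
    · exact Finset.disjoint_left.1 hGR hcG heR
    · have heD := Finset.mem_of_mem_erase he
      refine h.cut e heD heR hew (hs.mono fun x hx => ?_)
      rw [heq, Finset.mem_filter, Finset.mem_insert] at hx
      obtain ⟨rfl | hx, hxe⟩ := hx
      · exact absurd (hdmax e (Finset.mem_inter.2 ⟨heD, heR⟩)) (not_le.2 hxe)
      · exact Finset.mem_filter.2 ⟨Finset.mem_of_mem_erase hx, hxe⟩
  · intro e he hn f hf
    rw [heq] at hn ⊢
    refine Spans.trans (fun x hx => ?_) (h.corank e he (fun hs => hn (Spans.trans hnew hs)) f hf)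
    rcases Finset.mem_insert.1 hx with rfl | hx
    · exact Spans.of_mem (Finset.mem_insert_self _ _)
    · exact (hnew x hx).mono (Finset.subset_insert _ _)
  · rw [Finset.card_insert_of_notMem (fun hc => hcD (Finset.mem_of_mem_erase hc)),
      Finset.card_erase_add_one hdD]
  · refine hH.of_forall_spans (Spans.of_erase (fun e he => Spans.of_mem he) (hcK'.mono ?_))
    exact Finset.insert_subset (Finset.mem_erase.2 ⟨hcd.symm, h.subset hdD⟩)
      (Finset.erase_subset_erase _ (hKS.trans Finset.sdiff_subset))
  · rw [heq]
    exact fun hc => hc.of_forall_spans hold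
  · rw [heq, hsum]
    intro F hF hFs
    obtain ⟨F', h1, h2, h3⟩ := exists_spanning_of_swap hw (by simp [hdD]) hKS hKd hcmax hdc hc hF hFs
    exact ⟨F', h1, h2, by linarith⟩

end Target

/-! ### Series and positions. -/

namespace Arena

variable {V E : Type*} {A : Arena V E}

theorem totalBusted_append (S : List (Round E)) (r : Round E) :
    A.totalBusted (S ++ [r]) = A.totalBusted S + r.bust.card := by
  simp [totalBusted]

theorem totalCost_append (S : List (Round E)) (r : Round E) :
    A.totalCost (S ++ [r]) = A.totalCost S + A.weight r.fix := by
  simp [totalCost]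

variable [DecidableEq E]

theorem pos_append (S : List (Round E)) (r : Round E) :
    A.pos (S ++ [r]) = (A.pos S).next r := by
  simp [pos]

theorem fixerWins_append {S : List (Round E)} {r : Round E} :
    A.FixerWins (S ++ [r]) ↔ A.Fixable (A.pos S) r.bust := by
  constructor
  · rintro ⟨P, r', h, hf⟩
    obtain ⟨rfl, rfl⟩ := List.append_singleton_inj.1 h
    exact hf
  · exact fun h => ⟨S, r, rfl, h⟩

theorem busterWins_append {S : List (Round E)} {r : Round E} :
    A.BusterWins (S ++ [r]) ↔ ¬ A.Fixable (A.pos S) r.bust := by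
  constructor
  · rintro ⟨P, r', h, hf⟩
    obtain ⟨rfl, rfl⟩ := List.append_singleton_inj.1 h
    exact hf
  · exact fun h => ⟨S, r, rfl, h⟩

theorem IsSeries.legal {S : List (Round E)} {r : Round E} (h : A.IsSeries (S ++ [r])) :
    A.Legal (A.pos S) r := (h.2 S r [] rfl).1

theorem IsSeries.append {S : List (Round E)} {r : Round E} (h : A.IsSeries S)
    (hS : A.FixerWins S) (hr : A.Legal (A.pos S) r) : A.IsSeries (S ++ [r]) := by
  refine ⟨by simp, fun P r' Q hP => ?_⟩
  rcases List.eq_nil_or_concat Q with rfl | ⟨Q', q, rfl⟩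
  · obtain ⟨rfl, rfl⟩ := List.append_singleton_inj.1 hP
    exact ⟨hr, fun h => absurd rfl h⟩
  · have hS' : S = P ++ r' :: Q' := by
      have : S ++ [r] = (P ++ r' :: Q') ++ [q] := by simpa using hP
      exact (List.append_singleton_inj.1 this).1
    refine ⟨(h.2 P r' Q' hS').1, fun _ => ?_⟩
    rcases List.eq_nil_or_concat Q' with rfl | ⟨Q'', q', rfl⟩
    · subst hS'
      exact fixerWins_append.1 hS
    · exact (h.2 P r' _ hS').2 (by simp)

theorem IsSeries.of_prefix {S T : List (Round E)} (h : A.IsSeries T) (hS : S <+: T)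
    (hne : S ≠ []) : A.IsSeries S := by
  obtain ⟨L, rfl⟩ := hS
  refine ⟨hne, fun P r Q hP => ?_⟩
  obtain ⟨h1, h2⟩ := h.2 P r (Q ++ L) (by simp [hP])
  exact ⟨h1, fun hQ => h2 (by simp [hQ])⟩

theorem IsSeries.fixerWins {S : List (Round E)} {r : Round E} (h : A.IsSeries (S ++ [r]))
    (hne : S ≠ []) : A.FixerWins S := by
  rcases List.eq_nil_or_concat S with rfl | ⟨P, q, rfl⟩
  · exact absurd rfl hne
  · rw [List.concat_eq_append, fixerWins_append]
    exact (h.2 P q [r] (by simp)).2 (by simp)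

theorem fixerWins_or_busterWins {S : List (Round E)} (hS : S ≠ []) :
    A.FixerWins S ∨ A.BusterWins S := by
  rcases List.eq_nil_or_concat S with rfl | ⟨P, q, rfl⟩
  · exact absurd rfl hS
  · rw [List.concat_eq_append, fixerWins_append, busterWins_append]
    exact em _

theorem disjoint_pos_of_legal {S : List (Round E)}
    (h : ∀ P r Q, S = P ++ r :: Q → A.Legal (A.pos P) r) :
    Disjoint (A.pos S).G (A.pos S).R ∧ (A.pos S).R ⊆ A.R := by
  induction S using List.reverseRecOn with
  | nil => exact ⟨A.disjoint_GR, Finset.Subset.refl _⟩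
  | append_singleton S r ih =>
    obtain ⟨h1, h2⟩ := ih fun P r' Q hP => h P r' (Q ++ [r]) (by simp [hP])
    rw [pos_append]
    refine ⟨?_, Finset.sdiff_subset.trans h2⟩
    rw [Position.next, Finset.disjoint_union_left]
    exact ⟨Finset.disjoint_of_subset_left Finset.sdiff_subset
      (Finset.disjoint_of_subset_right Finset.sdiff_subset h1), Finset.disjoint_sdiff⟩

theorem IsSeries.connected {S : List (Round E)} (h : A.IsSeries S) (hS : A.FixerWins S) :
    EdgeConnected A.ends (A.pos S).G := by
  obtain ⟨P, r, rfl, hr⟩ := hS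
  rw [pos_append]
  exact h.legal.2.2.2.1 hr

/-- A purchase only moves an edge from the reserve to the graph, so the union depends on the
deletions alone. -/
theorem next_union {p : Position E} {r : Round E} (hr : r.bust ⊆ p.G) (hr' : r.fix ⊆ p.R)
    (hd : Disjoint p.G p.R) : (p.next r).G ∪ (p.next r).R = (p.G ∪ p.R) \ r.bust := by
  ext e
  have := @hr e
  have := @hr' e
  have : e ∈ p.G → e ∉ p.R := fun h => Finset.disjoint_left.1 hd h
  simp only [Position.next, Finset.mem_union, Finset.mem_sdiff]
  tauto

theorem fixable_iff {p : Position E} {B : Finset E} (hB : B ⊆ p.G) (hd : Disjoint p.G p.R) :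
    A.Fixable p B ↔ EdgeConnected A.ends ((p.G ∪ p.R) \ B) := by
  have : (p.G ∪ p.R) \ B = p.G \ B ∪ p.R := by
    ext e
    have := @hB e
    have : e ∈ p.G → e ∉ p.R := fun h => Finset.disjoint_left.1 hd h
    simp only [Finset.mem_union, Finset.mem_sdiff]
    tauto
  rw [this, Fixable]

theorem sum_next {p : Position E} {r : Round E} (hr : r.bust ⊆ p.G) (hr' : r.fix ⊆ p.R)
    (hd : Disjoint p.G p.R) (w : E → ℝ) :
    ∑ e ∈ (p.next r).G, w e = ∑ e ∈ p.G, w e - ∑ e ∈ r.bust, w e + ∑ e ∈ r.fix, w e := by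
  rw [Position.next, Finset.sum_union, ← Finset.sum_sdiff hr]
  · ring
  · exact Finset.disjoint_of_subset_left Finset.sdiff_subset
      (Finset.disjoint_of_subset_right hr' hd)

/-! ### Buster's play against an arbitrary strategy. -/

/-- Against any Fixer strategy, Buster can achieve a result as good as if he deleted `D` and Fixer
had bought the whole of `D` and a spanning set of least weight of the rest. -/
theorem IsFixerStrategy.exists_play {S : List (Round E)} {k : ℕ} {φ : Set (List (Round E))}
    (hφ : A.IsFixerStrategy S k φ) {w : E → ℝ} (hw : ∀ e, 0 ≤ w e) {R₀ : Finset E}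
    (hwR : ∀ e ∈ R₀, w e = A.w e) (n : ℕ) :
    ∀ T ∈ φ, A.FixerWins T → (A.pos T).R ⊆ R₀ → ∀ D : Finset E, D.card = n →
      IsTarget A.ends w ((A.pos T).G ∪ (A.pos T).R) (A.pos T).R D → ∀ val : ℝ,
      (∀ F ⊆ ((A.pos T).G ∪ (A.pos T).R) \ D,
        (∀ e ∈ ((A.pos T).G ∪ (A.pos T).R) \ D, Spans A.ends F e) → val ≤ ∑ e ∈ F, w e) →
      ∃ U ∈ φ, (¬ EdgeConnected A.ends (((A.pos T).G ∪ (A.pos T).R) \ D) → A.BusterWins U) ∧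
        A.totalBusted U ≤ A.totalBusted T + n ∧
        A.totalCost T - ∑ e ∈ (A.pos T).G, w e + ∑ e ∈ D, w e + val ≤ A.totalCost U := by
  induction n using Nat.strong_induction_on with
  | _ n ih =>
  intro T hT hTF hTR
  have hTs := hφ.isSeries T hT
  have hG := hTs.connected hTF
  obtain ⟨hd, -⟩ := disjoint_pos_of_legal fun P r Q h => (hTs.2 P r Q h).1
  have hH : EdgeConnected A.ends ((A.pos T).G ∪ (A.pos T).R) := hG.mono Finset.subset_union_left
  have hresp : ∀ d ∈ (A.pos T).G, ∃ F, T ++ [⟨{d}, F⟩] ∈ φ := fun d hdG => by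
    obtain ⟨_, ⟨h1, F, rfl⟩, -⟩ :=
      hφ.respond T hT hTF {d} (Finset.singleton_subset_iff.2 hdG) (Finset.singleton_nonempty d)
    exact ⟨F, h1⟩
  -- Buster deletes the non-bridge `d`, which leaves the target as well. The survivors and the
  -- quantity cost − `w(G)` + `w(D)` do not change, so the same `val` serves in the induction.
  have step : ∀ D : Finset E, D.card = n →
      IsTarget A.ends w ((A.pos T).G ∪ (A.pos T).R) (A.pos T).R D →
      (∃ d ∈ D, d ∈ (A.pos T).G ∧
        EdgeConnected A.ends (((A.pos T).G ∪ (A.pos T).R).erase d)) → ∀ val : ℝ,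
      (∀ F ⊆ ((A.pos T).G ∪ (A.pos T).R) \ D,
        (∀ e ∈ ((A.pos T).G ∪ (A.pos T).R) \ D, Spans A.ends F e) → val ≤ ∑ e ∈ F, w e) →
      ∃ U ∈ φ, (¬ EdgeConnected A.ends (((A.pos T).G ∪ (A.pos T).R) \ D) → A.BusterWins U) ∧
        A.totalBusted U ≤ A.totalBusted T + n ∧
        A.totalCost T - ∑ e ∈ (A.pos T).G, w e + ∑ e ∈ D, w e + val ≤ A.totalCost U := by
    rintro D hDn hD ⟨d, hdD, hdG, hdc⟩ val hval
    obtain ⟨F, hU⟩ := hresp d hdG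
    have hleg := (hφ.isSeries _ hU).legal
    have hfix : A.Fixable (A.pos T) {d} := by
      rw [fixable_iff hleg.2.1 hd, Finset.sdiff_singleton_eq_erase]
      exact hdc
    have hun := next_union hleg.2.1 hleg.2.2.1 hd
    have hsum := sum_next hleg.2.1 hleg.2.2.1 hd w
    rw [← pos_append] at hun hsum
    rw [Finset.sdiff_singleton_eq_erase] at hun
    have hsubR : (A.pos (T ++ [⟨{d}, F⟩])).R ⊆ (A.pos T).R := by
      rw [pos_append]; exact Finset.sdiff_subset
    have hcard := Finset.card_erase_add_one hdD
    have := ih (D.erase d).card (by omega) _ hU (fixerWins_append.2 hfix) (hsubR.trans hTR)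
      (D.erase d) rfl (by rw [hun]; exact hD.erase hsubR hdD) val
    rw [hun, sdiff_erase_erase hdD] at this
    obtain ⟨U, hUφ, h1, h2, h3⟩ := this hval
    refine ⟨U, hUφ, h1, ?_, ?_⟩
    · rw [totalBusted_append, Finset.card_singleton] at h2
      omega
    · have hF : A.weight F = ∑ e ∈ F, w e :=
        Finset.sum_congr rfl fun e he => (hwR e (hTR (hleg.2.2.1 he))).symm
      rw [totalCost_append, hsum, Finset.sum_singleton] at h3
      have := Finset.add_sum_erase D w hdD
      simp only at h3
      linarith
  intro D hDn hD val hval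
  by_cases hbr : ∀ d ∈ D, d ∈ (A.pos T).G →
      ¬ EdgeConnected A.ends (((A.pos T).G ∪ (A.pos T).R).erase d)
  swap
  · push Not at hbr
    exact step D hDn hD hbr val hval
  by_cases hpos : ∃ d ∈ D, d ∈ (A.pos T).R ∧ 0 < w d
  · obtain ⟨D', c, hD', hcard, hcD', hcG, hcc, hcon, hF⟩ := hD.exists_swap hw hd hG hbr hpos
    -- The shift of `val` offsets the change of target weight; the sum of the two stays fixed.
    obtain ⟨U, hU, h1, h2, h3⟩ := step D' (hcard.trans hDn) hD' ⟨c, hcD', hcG, hcc⟩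
      (val + ∑ e ∈ D, w e - ∑ e ∈ D', w e) fun F hF' hFs => by
        obtain ⟨F', h1, h2, h3⟩ := hF F hF' hFs
        have := hval F' h1 h2
        linarith
    exact ⟨U, hU, fun h => h1 fun h' => h (hcon h'), h2, by linarith⟩
  push Not at hpos
  -- Now `G \ D` spans all survivors and the weight of `D` lies in `G`, so the required lower bound
  -- is at most the cost already paid.
  have hval' := hval ((A.pos T).G \ D)
    (Finset.sdiff_subset_sdiff Finset.subset_union_left (Finset.Subset.refl _)) fun e he => by
      rw [Finset.mem_sdiff] at he
      exact hD.spans_of_bridges hG hbr he.1 fun h => absurd h he.2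
  have hsumD : ∑ e ∈ D, w e ≤ ∑ e ∈ (A.pos T).G ∩ D, w e := by
    rw [Finset.inter_comm]
    refine (Finset.sum_subset Finset.inter_subset_left fun e he hn => ?_).ge
    rw [Finset.mem_inter, not_and] at hn
    exact le_antisymm (hpos e he ((Finset.mem_union.1 (hD.subset he)).resolve_left (hn he))) (hw e)
  have hsumG := Finset.sum_inter_add_sum_sdiff (A.pos T).G D w
  by_cases hDG : ∃ b ∈ D, b ∈ (A.pos T).G
  · obtain ⟨b, hbD, hbG⟩ := hDG
    obtain ⟨F, hU⟩ := hresp b hbG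
    have hleg := (hφ.isSeries _ hU).legal
    have hfix : ¬ A.Fixable (A.pos T) {b} := by
      rw [fixable_iff hleg.2.1 hd, Finset.sdiff_singleton_eq_erase]
      exact hbr b hbD hbG
    have hF : F = ∅ := hleg.2.2.2.2 hfix
    refine ⟨_, hU, fun _ => busterWins_append.2 hfix, ?_, ?_⟩
    · rw [totalBusted_append, Finset.card_singleton]
      have := Finset.card_pos.2 ⟨b, hbD⟩
      omega
    · rw [totalCost_append]
      simp only [hF, weight, Finset.sum_empty]
      linarith
  · push Not at hDG
    refine ⟨T, hT, fun h => absurd (hG.mono fun e he => ?_) h, by omega, by linarith⟩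
    exact Finset.mem_sdiff.2 ⟨Finset.mem_union_left _ he, fun h => hDG e h he⟩

end Arena
-- Greedy moves and greedy strategies.
namespace Arena

variable {V E : Type*} [DecidableEq E] {A : Arena V E}

theorem isSeries_singleton {r : Round E} (h : A.Legal (A.pos []) r) : A.IsSeries [r] := by
  refine ⟨by simp, fun P r' Q hP => ?_⟩
  rcases P with _ | ⟨q, P⟩
  · obtain ⟨rfl, rfl⟩ := List.cons_eq_cons.1 hP
    exact ⟨h, fun h => absurd rfl h⟩
  · simp at hP

theorem IsSeries.replace_last {P : List (Round E)} {r r' : Round E} (h : A.IsSeries (P ++ [r]))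
    (h' : A.Legal (A.pos P) r') : A.IsSeries (P ++ [r']) := by
  by_cases hP : P = []
  · subst hP
    exact isSeries_singleton h'
  · exact (h.of_prefix (List.prefix_append _ _) hP).append (h.fixerWins hP) h'

/-- The round `r` is legal, and no other legal answer to the same Buster move is cheaper. -/
def IsCheapest (A : Arena V E) (p : Position E) (r : Round E) : Prop :=
  A.Legal p r ∧ ∀ F, A.Legal p ⟨r.bust, F⟩ → A.weight r.fix ≤ A.weight F

theorem exists_isCheapest {p : Position E} {B : Finset E} (hB : B ⊆ p.G) (hne : B.Nonempty) :
    ∃ F, A.IsCheapest p ⟨B, F⟩ := by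
  classical
  have hs : (p.R.powerset.filter fun F => A.Legal p ⟨B, F⟩).Nonempty := by
    by_cases hf : A.Fixable p B
    · exact ⟨p.R, Finset.mem_filter.2 ⟨Finset.mem_powerset_self _, hne, hB,
        Finset.Subset.refl _, fun h => h, fun h => absurd hf h⟩⟩
    · exact ⟨∅, Finset.mem_filter.2 ⟨Finset.empty_mem_powerset _, hne, hB,
        Finset.empty_subset _, fun h => absurd h hf, fun _ => rfl⟩⟩
  obtain ⟨F, hF, hmin⟩ := Finset.exists_min_image _ A.weight hs
  exact ⟨F, (Finset.mem_filter.1 hF).2, fun F' hF' => hmin F' (Finset.mem_filter.2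
    ⟨Finset.mem_powerset.2 hF'.2.2.1, hF'⟩)⟩

open Classical in
/-- A cheapest answer to the Buster move `B`. -/
noncomputable def cheapestFix (A : Arena V E) (p : Position E) (B : Finset E) : Finset E :=
  if h : ∃ F, A.IsCheapest p ⟨B, F⟩ then h.choose else ∅

theorem isCheapest_cheapestFix {p : Position E} {B : Finset E} (hB : B ⊆ p.G) (hne : B.Nonempty) :
    A.IsCheapest p ⟨B, A.cheapestFix p B⟩ := by
  have h := exists_isCheapest (A := A) hB hne
  rw [cheapestFix, dif_pos h]
  exact h.choose_spec

/-- The series in which Fixer makes greedy moves after the `k`th round of `S`. -/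
def greedyStrategy (A : Arena V E) (S : List (Round E)) (k : ℕ) : Set (List (Round E)) :=
  {T | A.IsSeries T ∧ S.take k <+: T ∧
    ∀ P r, P ++ [r] <+: T → k ≤ P.length → r.fix = A.cheapestFix (A.pos P) r.bust}

theorem isFixerStrategy_greedyStrategy {S : List (Round E)} (hS : A.IsSeries S) {k : ℕ}
    (hk : 1 ≤ k) (hkS : k ≤ S.length) : A.IsFixerStrategy S k (A.greedyStrategy S k) where
  isSeries T hT := hT.1
  root_mem := by
    have hlen : (S.take k).length = k := by simp [hkS]
    refine ⟨hS.of_prefix (List.take_prefix _ _) (List.ne_nil_of_length_pos (by omega)),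
      List.prefix_rfl, fun P r h hP => ?_⟩
    have := h.length_le
    simp only [List.length_append, List.length_singleton, hlen] at this
    omega
  respond T hT hTF B hB hne := by
    have hc := isCheapest_cheapestFix (A := A) hB hne
    have hlen : k ≤ T.length := by simpa [hkS] using hT.2.1.length_le
    refine ⟨T ++ [⟨B, A.cheapestFix (A.pos T) B⟩], ⟨⟨hT.1.append hTF hc.1,
      hT.2.1.trans (List.prefix_append _ _), fun P r h hP => ?_⟩, _, rfl⟩, ?_⟩
    · rcases List.prefix_concat_iff.1 h with h | h
      · obtain ⟨rfl, rfl⟩ := List.append_singleton_inj.1 h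
        rfl
      · exact hT.2.2 P r h hP
    · rintro _ ⟨hU, F, rfl⟩
      have := hU.2.2 T ⟨B, F⟩ List.prefix_rfl hlen
      simp only at this
      rw [this]
  take_eq T hT := by
    have := List.prefix_iff_eq_take.1 hT.2.1
    rw [this]
    simp [hkS]
  consistent T hT U hU P B F F' hF hF' := by
    by_cases hP : k ≤ P.length
    · exact (hT.2.2 P _ hF hP).trans (hU.2.2 P _ hF' hP).symm
    · have h : ∀ (r : Round E) (W : List (Round E)), S.take k <+: W → P ++ [r] <+: W →
          P ++ [r] <+: S.take k := fun r W h1 h2 =>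
        List.prefix_of_prefix_length_le h2 h1 (by simp [hkS]; omega)
      have h1 := h _ T hT.2.1 hF
      have h2 := h _ U hU.2.1 hF'
      have h3 := List.prefix_of_prefix_length_le h1 h2 (by simp)
      have h4 := h3.eq_of_length (by simp)
      simpa using h4

/-! ### Greedy positions. -/

/-- Positions that arise from greedy play after the deletion of `D` from the edge set `H`: the
current graph is a connected spanning subgraph of least weight. -/
structure IsGreedyPosition (ends : E → Sym2 V) (w : E → ℝ) (H D : Finset E) (p : Position E) :
    Prop where
  subset : D ⊆ H
  union_eq : p.G ∪ p.R = H \ D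
  disjoint : Disjoint p.G p.R
  connected : EdgeConnected ends p.G
  minimal : ∀ F ⊆ H \ D, (∀ e ∈ H \ D, Spans ends F e) → ∑ e ∈ p.G, w e ≤ ∑ e ∈ F, w e
  cut : ∀ d ∈ D, 0 < w d → ¬ Spans ends ((H \ D).filter fun e => w e < w d) d

variable {w : E → ℝ} {H D : Finset E} {p : Position E}

theorem IsGreedyPosition.not_spans (h : IsGreedyPosition A.ends w H D p) {q : E} (hq : q ∈ p.G)
    (hpos : 0 < w q) :
    ¬ Spans A.ends (p.G.erase q ∪ (H \ D).filter fun e => w e < w q) q :=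
  not_spans_of_minimal (h.union_eq ▸ Finset.subset_union_left) (fun e _ => h.connected.spans e)
    h.minimal hq hpos

/-- For an old deletion there are only fewer survivors; for a new one, the cut property of the
least-weight graph `p.G` applies. -/
theorem IsGreedyPosition.cut_union (h : IsGreedyPosition A.ends w H D p) {B : Finset E}
    (hB : B ⊆ p.G) : ∀ d ∈ D ∪ B, 0 < w d →
      ¬ Spans A.ends ((H \ (D ∪ B)).filter fun e => w e < w d) d := by
  intro d hd hpos hs
  have hsub : ((H \ (D ∪ B)).filter fun e => w e < w d) ⊆ (H \ D).filter fun e => w e < w d :=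
    Finset.filter_subset_filter _
      (Finset.sdiff_subset_sdiff (Finset.Subset.refl _) Finset.subset_union_left)
  rcases Finset.mem_union.1 hd with hd | hd
  · exact h.cut d hd hpos (hs.mono hsub)
  · exact h.not_spans (hB hd) hpos (hs.mono (hsub.trans Finset.subset_union_right))

/-- All positive edges of `p.G \ B` can be forced into a spanning set at no cost. A competitor
therefore pays for the surviving graph plus a purchase `F' \ p.G`. -/
theorem IsGreedyPosition.exists_superset (h : IsGreedyPosition A.ends w H D p)
    (hw : ∀ e, 0 ≤ w e) {B F : Finset E} (hF : F ⊆ H \ (D ∪ B))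
    (hFs : ∀ e ∈ H \ (D ∪ B), Spans A.ends F e) :
    ∃ F' ⊆ H \ (D ∪ B), (∀ e ∈ H \ (D ∪ B), Spans A.ends F' e) ∧
      ∑ e ∈ p.G \ B, w e + ∑ e ∈ F' \ p.G, w e ≤ ∑ e ∈ F, w e := by
  have hsub : p.G ⊆ H \ D := h.union_eq ▸ Finset.subset_union_left
  obtain ⟨F', h1, h2, h3, h4⟩ := exists_spanning_superset
    (Finset.sdiff_subset_sdiff (Finset.Subset.refl H) (Finset.subset_union_left (s₂ := B)))
    (fun q hq hpos => h.not_spans hq hpos) hF hFs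
  refine ⟨F', h1, h2, le_trans ?_ h3⟩
  have h5 := sum_inter_le_of_positive_subset hw (G := p.G \ B) (F := F') fun q hq hpos => by
    rw [Finset.mem_sdiff] at hq
    have := Finset.mem_sdiff.1 (hsub hq.1)
    refine h4 q hq.1 ?_ hpos
    rw [Finset.mem_sdiff, Finset.mem_union]
    exact ⟨this.1, by tauto⟩
  have h6 : ∑ e ∈ F' ∩ (p.G \ B), w e ≤ ∑ e ∈ F' ∩ p.G, w e :=
    Finset.sum_le_sum_of_subset_of_nonneg
      (Finset.inter_subset_inter (Finset.Subset.refl _) Finset.sdiff_subset) fun e _ _ => hw e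
  have h7 := Finset.sum_inter_add_sum_sdiff F' p.G w
  linarith

/-- Local thrift gives a global minimum: by `exists_superset`, any competitor contains the price of
a legal answer, and the greedy answer is no dearer. -/
theorem IsGreedyPosition.next (h : IsGreedyPosition A.ends w H D p) (hw : ∀ e, 0 ≤ w e)
    (hwR : ∀ e ∈ p.R, w e = A.w e) {r : Round E} (hr : A.IsCheapest p r)
    (hf : A.Fixable p r.bust) :
    IsGreedyPosition A.ends w H (D ∪ r.bust) (p.next r) := by
  obtain ⟨⟨hne, hB, hF, hcon, -⟩, hmin⟩ := hr
  have hsdiff : H \ (D ∪ r.bust) = (p.G ∪ p.R) \ r.bust := by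
    rw [h.union_eq, Finset.sdiff_sdiff_left']
    ext e
    simp only [Finset.mem_sdiff, Finset.mem_union, Finset.mem_inter]
    tauto
  have hweight : ∀ F ⊆ p.R, A.weight F = ∑ e ∈ F, w e := fun F hF' =>
    Finset.sum_congr rfl fun e he => (hwR e (hF' he)).symm
  refine ⟨?_, ?_, ?_, hcon hf, ?_, h.cut_union hB⟩
  · exact Finset.union_subset h.subset (hB.trans
      ((h.union_eq ▸ Finset.subset_union_left : p.G ⊆ H \ D).trans Finset.sdiff_subset))
  · rw [next_union hB hF h.disjoint, hsdiff]
  · rw [Position.next, Finset.disjoint_union_left]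
    exact ⟨Finset.disjoint_of_subset_left Finset.sdiff_subset
      (Finset.disjoint_of_subset_right Finset.sdiff_subset h.disjoint), Finset.disjoint_sdiff⟩
  · intro F₀ hF₀ hFs
    obtain ⟨F', h1, h2, h3⟩ := h.exists_superset hw hF₀ hFs
    have hFR : F' \ p.G ⊆ p.R := by
      intro e he
      rw [Finset.mem_sdiff] at he
      have := h1 he.1
      rw [hsdiff, Finset.mem_sdiff, Finset.mem_union] at this
      tauto
    have hcF : EdgeConnected A.ends ((p.G \ r.bust) ∪ (F' \ p.G)) := by
      rw [fixable_iff hB h.disjoint, ← hsdiff] at hf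
      refine (hf.of_forall_spans h2).mono fun e he => ?_
      have := h1 he
      rw [hsdiff] at this
      simp only [Finset.mem_sdiff, Finset.mem_union] at this ⊢
      tauto
    have h4 := hmin (F' \ p.G) ⟨hne, hB, hFR, fun _ => hcF, fun hn => absurd hf hn⟩
    rw [hweight _ hF, hweight _ hFR] at h4
    have h5 := sum_next hB hF h.disjoint w
    have h6 := Finset.sum_sdiff hB (f := w)
    linarith

/-- This starts the induction: since `w` vanishes off the reserve, a spanning set costs as much as
its reserve part, which is itself a legal answer. -/
theorem isGreedyPosition_next {r : Round E} (hd : Disjoint p.G p.R)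
    (hwG : ∀ e ∉ p.R, w e = 0) (hwR : ∀ e ∈ p.R, w e = A.w e)
    (hr : A.IsCheapest p r) (hf : A.Fixable p r.bust) :
    IsGreedyPosition A.ends w ((p.G ∪ p.R) \ r.bust) ∅ (p.next r) := by
  obtain ⟨⟨hne, hB, hF, hcon, -⟩, hmin⟩ := hr
  have hweight : ∀ F ⊆ p.R, A.weight F = ∑ e ∈ F, w e := fun F hF' =>
    Finset.sum_congr rfl fun e he => (hwR e (hF' he)).symm
  have hzero : ∀ F, ∑ e ∈ F \ p.R, w e = 0 := fun F =>
    Finset.sum_eq_zero fun e he => hwG e (Finset.mem_sdiff.1 he).2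
  refine ⟨Finset.empty_subset _, ?_, ?_, hcon hf, ?_, by simp⟩
  · rw [next_union hB hF hd, Finset.sdiff_empty]
  · rw [Position.next, Finset.disjoint_union_left]
    exact ⟨Finset.disjoint_of_subset_left Finset.sdiff_subset
      (Finset.disjoint_of_subset_right Finset.sdiff_subset hd), Finset.disjoint_sdiff⟩
  · intro F₀ hF₀ hFs
    rw [Finset.sdiff_empty] at hF₀ hFs
    have hcF : EdgeConnected A.ends ((p.G \ r.bust) ∪ (F₀ ∩ p.R)) := by
      rw [fixable_iff hB hd] at hf
      refine (hf.of_forall_spans hFs).mono fun e he => ?_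
      have := hF₀ he
      simp only [Finset.mem_sdiff, Finset.mem_union, Finset.mem_inter] at this ⊢
      tauto
    have h4 := hmin (F₀ ∩ p.R) ⟨hne, hB, Finset.inter_subset_right, fun _ => hcF,
      fun hn => absurd hf hn⟩
    rw [hweight _ hF, hweight _ Finset.inter_subset_right] at h4
    have h5 := sum_next hB hF hd w
    have h6 : ∑ e ∈ p.G, w e = 0 :=
      Finset.sum_eq_zero fun e he => hwG e (Finset.disjoint_left.1 hd he)
    have h7 : ∑ e ∈ r.bust, w e = 0 :=
      Finset.sum_eq_zero fun e he => hwG e (Finset.disjoint_left.1 hd (hB he))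
    have h8 := Finset.sum_inter_add_sum_sdiff F₀ p.R w
    have h9 := hzero F₀
    linarith

/-- After greedy play, the deleted edges, possibly together with a minimal set `B` that Buster
needs in order to win, are a target. -/
theorem IsGreedyPosition.isTarget (h : IsGreedyPosition A.ends w H D p) {B R : Finset E}
    (hB : B ⊆ p.G) (hmin : ∀ b ∈ B, EdgeConnected A.ends ((p.G ∪ p.R) \ B.erase b)) :
    IsTarget A.ends w H R (D ∪ B) where
  subset := Finset.union_subset h.subset (hB.trans
    ((h.union_eq ▸ Finset.subset_union_left : p.G ⊆ H \ D).trans Finset.sdiff_subset))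
  cut d hd _ hpos := h.cut_union hB d hd hpos
  corank e _ hn f _ := by
    have hsub : p.G ⊆ H \ D := h.union_eq ▸ Finset.subset_union_left
    obtain ⟨b, hb⟩ : B.Nonempty := by
      rw [Finset.nonempty_iff_ne_empty]
      rintro rfl
      rw [Finset.union_empty] at hn
      exact hn ((h.connected.spans e).mono hsub)
    -- Restoring any one `b` reconnects the survivors, and `e` can then stand in for `b`.
    have hc : EdgeConnected A.ends (insert b (H \ (D ∪ B))) := by
      refine (hmin b hb).mono fun x hx => ?_
      rw [h.union_eq] at hx
      simp only [Finset.mem_sdiff, Finset.mem_union, Finset.mem_insert, Finset.mem_erase] at hx ⊢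
      tauto
    have hs := Spans.exchange (hc.spans e) hn
    refine Spans.trans (fun x hx => ?_) (hc.spans f)
    rcases Finset.mem_insert.1 hx with rfl | hx
    · exact hs
    · exact Spans.of_mem (Finset.mem_insert_of_mem hx)

/-- Minimality provides the corank condition when Buster's winning deletion is added to a target. -/
theorem exists_minimal_disconnecting {ends : E → Sym2 V} {H B : Finset E}
    (h : ¬ EdgeConnected ends (H \ B)) :
    ∃ B' ⊆ B, ¬ EdgeConnected ends (H \ B') ∧ ∀ b ∈ B', EdgeConnected ends (H \ B'.erase b) := by
  induction B using Finset.strongInduction with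
  | H B ih =>
    by_cases hB : ∃ b ∈ B, ¬ EdgeConnected ends (H \ B.erase b)
    · obtain ⟨b, hb, hbn⟩ := hB
      obtain ⟨K, hK, hK'⟩ := ih _ (Finset.erase_ssubset hb) hbn
      exact ⟨K, hK.trans (Finset.erase_subset _ _), hK'⟩
    · push Not at hB
      exact ⟨B, Finset.Subset.refl _, h, hB⟩

/-- The outcome of greedy play, as long as Fixer is not beaten. -/
theorem exists_isGreedyPosition {S : List (Round E)} {k : ℕ} (hw : ∀ e, 0 ≤ w e)
    (hwR : ∀ e ∈ (A.pos (S.take k)).R, w e = A.w e) (hk : 1 ≤ k) (hkS : k ≤ S.length)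
    (h₀ : IsGreedyPosition A.ends w H ∅ (A.pos (S.take k))) (T : List (Round E)) :
    T ∈ A.greedyStrategy S k → A.FixerWins T →
    ∃ D, IsGreedyPosition A.ends w H D (A.pos T) ∧ (A.pos T).R ⊆ (A.pos (S.take k)).R ∧
      A.totalBusted T = A.totalBusted (S.take k) + D.card ∧
      A.totalCost T = A.totalCost (S.take k) - ∑ e ∈ (A.pos (S.take k)).G, w e + ∑ e ∈ D, w e +
        ∑ e ∈ (A.pos T).G, w e := by
  have hlen : (S.take k).length = k := by simp [hkS]
  induction T using List.reverseRecOn with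
  | nil =>
    rintro ⟨⟨h, -⟩, -⟩
    exact absurd rfl h
  | append_singleton T r ih =>
    rintro ⟨hs, hpre, hg⟩ hTF
    rcases List.prefix_concat_iff.1 hpre with heq | hpre'
    · rw [← heq]
      exact ⟨∅, h₀, Finset.Subset.refl _, by simp, by simp⟩
    · have hkT : k ≤ T.length := by simpa [hlen] using hpre'.length_le
      have hne : T ≠ [] := List.ne_nil_of_length_pos (by omega)
      obtain ⟨D, h1, h2, h3, h4⟩ := ih ⟨hs.of_prefix (List.prefix_append _ _) hne, hpre',
        fun P q hP => hg P q (hP.trans (List.prefix_append _ _))⟩ (hs.fixerWins hne)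
      have hleg := hs.legal
      have hr : A.IsCheapest (A.pos T) r := by
        have hfix := hg T r List.prefix_rfl hkT
        have := isCheapest_cheapestFix (A := A) hleg.2.1 hleg.1
        rwa [← hfix] at this
      have hwT : ∀ e ∈ (A.pos T).R, w e = A.w e := fun e he => hwR e (h2 he)
      have h5 := h1.next hw hwT hr (fixerWins_append.1 hTF)
      have hdis : Disjoint D r.bust := by
        refine Finset.disjoint_right.2 fun e he => ?_
        have : e ∈ H \ D := h1.union_eq ▸ Finset.mem_union_left _ (hleg.2.1 he)
        exact (Finset.mem_sdiff.1 this).2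
      rw [← pos_append] at h5
      refine ⟨D ∪ r.bust, h5, ?_, ?_, ?_⟩
      · rw [pos_append]
        exact Finset.sdiff_subset.trans h2
      · rw [totalBusted_append, h3, Finset.card_union_of_disjoint hdis]
        omega
      · have h6 := sum_next hleg.2.1 hleg.2.2.1 h1.disjoint w
        have h7 : A.weight r.fix = ∑ e ∈ r.fix, w e :=
          Finset.sum_congr rfl fun e he => (hwT e (hleg.2.2.1 he)).symm
        rw [totalCost_append, pos_append, h6, Finset.sum_union hdis, h4, h7]
        ring

/-! ### Comparison of greedy play with an arbitrary strategy. -/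

/-- Every series with greedy Fixer moves is at least as good for Fixer as some series of an
arbitrary strategy. -/
theorem exists_fixerSuperior {S S' : List (Round E)} {k : ℕ} (hk : 1 ≤ k) (hkS : k ≤ S.length)
    (hw : ∀ e, 0 ≤ w e) (hwR : ∀ e ∈ (A.pos (S.take k)).R, w e = A.w e)
    (hwR' : ∀ e ∈ (A.pos (S'.take k)).R, w e = A.w e)
    (h₀ : IsGreedyPosition A.ends w H ∅ (A.pos (S.take k)))
    (hS : A.FixerWins (S.take k)) (hS' : A.FixerWins (S'.take k))
    (hH : (A.pos (S'.take k)).G ∪ (A.pos (S'.take k)).R = H)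
    (hbust : A.totalBusted (S'.take k) = A.totalBusted (S.take k))
    (hcost : A.totalCost (S'.take k) - ∑ e ∈ (A.pos (S'.take k)).G, w e =
      A.totalCost (S.take k) - ∑ e ∈ (A.pos (S.take k)).G, w e)
    {φ' : Set (List (Round E))} (hφ' : A.IsFixerStrategy S' k φ')
    {T : List (Round E)} (hT : T ∈ A.greedyStrategy S k) : ∃ T' ∈ φ', A.FixerSuperior T T' := by
  have hplay := fun D => hφ'.exists_play hw hwR' D.card _ hφ'.root_mem hS' (Finset.Subset.refl _)
    D rfl
  rw [hH] at hplay
  by_cases hTF : A.FixerWins T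
  · obtain ⟨D, h1, -, h3, h4⟩ := exists_isGreedyPosition hw hwR hk hkS h₀ T hT hTF
    have ht := h1.isTarget (R := (A.pos (S'.take k)).R) (Finset.empty_subset _) (by simp)
    rw [Finset.union_empty] at ht
    obtain ⟨U, hU, -, h5, h6⟩ := hplay D ht _ h1.minimal
    exact ⟨U, hU, Or.inl hTF, by omega, by linarith⟩
  · obtain ⟨hs, hpre, hg⟩ := hT
    obtain ⟨P, r, rfl, hnf⟩ := (fixerWins_or_busterWins hs.1).resolve_left hTF
    have hpre' := (List.prefix_concat_iff.1 hpre).resolve_left fun h => hTF (h ▸ hS)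
    have hkP : k ≤ P.length := by simpa [hkS] using hpre'.length_le
    have hne : P ≠ [] := List.ne_nil_of_length_pos (by omega)
    obtain ⟨D, h1, -, h3, h4⟩ := exists_isGreedyPosition hw hwR hk hkS h₀ P
      ⟨hs.of_prefix (List.prefix_append _ _) hne, hpre',
        fun P' q hP => hg P' q (hP.trans (List.prefix_append _ _))⟩ (hs.fixerWins hne)
    have hleg := hs.legal
    have hfix : r.fix = ∅ := hleg.2.2.2.2 hnf
    have hnf' := hnf
    rw [fixable_iff hleg.2.1 h1.disjoint] at hnf'
    obtain ⟨B, hBr, hBn, hBmin⟩ := exists_minimal_disconnecting hnf'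
    have hBG := hBr.trans hleg.2.1
    have hdis : Disjoint D B := by
      refine Finset.disjoint_right.2 fun e he => ?_
      have : e ∈ H \ D := h1.union_eq ▸ Finset.mem_union_left _ (hBG he)
      exact (Finset.mem_sdiff.1 this).2
    -- With `val` equal to the weight of `G \ B`, target weight and `val` add up to `w(D)` + `w(G)`,
    -- matching the cost formula before the losing round.
    obtain ⟨U, hU, h5, h6, h7⟩ := hplay (D ∪ B) (h1.isTarget hBG hBmin)
      (∑ e ∈ (A.pos P).G \ B, w e) fun F hF hFs => by
        obtain ⟨F', -, -, h⟩ := h1.exists_superset hw hF hFs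
        have := Finset.sum_nonneg fun e (_ : e ∈ F' \ (A.pos P).G) => hw e
        linarith
    refine ⟨U, hU, Or.inr (h5 ?_), ?_, ?_⟩
    · rwa [h1.union_eq, Finset.sdiff_sdiff_left', ← Finset.sdiff_union_distrib] at hBn
    · rw [Finset.card_union_of_disjoint hdis] at h6
      have := Finset.card_le_card hBr
      rw [totalBusted_append]
      omega
    · have h8 := Finset.sum_sdiff hBG (f := w)
      rw [Finset.sum_union hdis] at h7
      rw [totalCost_append]
      simp only [hfix, weight, Finset.sum_empty]
      linarith

end Arena
-- The two directions of the equivalence.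
namespace Arena

theorem take_append_cons {E : Type*} (P Q : List (Round E)) (r : Round E) :
    (P ++ r :: Q).take (P.length + 1) = P ++ [r] := by
  simp [List.take_append]

variable {V E : Type*} [DecidableEq E] {A : Arena V E}

theorem isGreedyMove_iff {P Q : List (Round E)} {r : Round E} (hS : A.IsSeries (P ++ r :: Q)) :
    A.IsGreedyMove (P ++ r :: Q) (P.length + 1) ↔ A.IsCheapest (A.pos P) r := by
  have hS₁ : A.IsSeries (P ++ [r]) := hS.of_prefix ⟨Q, by simp⟩ (by simp)
  constructor
  · exact fun h => ⟨hS₁.legal, fun F hF => h (P ++ [⟨r.bust, F⟩]) r.fix F (hS₁.replace_last hF)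
      ⟨P, r.bust, Q, [], rfl, rfl, rfl⟩⟩
  · rintro ⟨-, h⟩ S' F F' hS' ⟨P', B, Q', Q'', hP', h1, rfl⟩
    obtain ⟨rfl, h2⟩ := List.append_inj h1 (by omega)
    obtain ⟨rfl, rfl⟩ := List.cons_eq_cons.1 h2
    exact h F' (hS'.2 _ _ _ rfl).1

theorem isOptimalMove_of_isCheapest {P Q : List (Round E)} {r : Round E}
    (hS : A.IsSeries (P ++ r :: Q)) (hr : A.IsCheapest (A.pos P) r) :
    A.IsOptimalMove (P ++ r :: Q) (P.length + 1) := by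
  classical
  have htake := take_append_cons P Q r
  have hk : 1 ≤ P.length + 1 := by omega
  have hkS : P.length + 1 ≤ (P ++ r :: Q).length := by simp
  refine ⟨_, isFixerStrategy_greedyStrategy hS hk hkS, ?_⟩
  rintro S' F F' hS' ⟨P', B, Q', Q'', hP', h1, rfl⟩ φ' hφ' T hT
  obtain ⟨rfl, h2⟩ := List.append_inj h1 (by omega)
  obtain ⟨rfl, rfl⟩ := List.cons_eq_cons.1 h2
  have htake' := take_append_cons P Q'' ⟨B, F'⟩
  have hleg := hr.1
  have hleg' : A.Legal (A.pos P) ⟨B, F'⟩ := (hS'.2 _ _ _ rfl).1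
  by_cases hf : A.Fixable (A.pos P) B
  · obtain ⟨hd, hRR⟩ := disjoint_pos_of_legal (A := A) (S := P) fun P' q Q₁ h =>
      (hS.2 P' q (Q₁ ++ ⟨B, F⟩ :: Q) (by simp [h])).1
    -- Edges outside the present reserve can cost nothing more, so they get weight zero; this also
    -- makes `w` nonnegative everywhere.
    let w : E → ℝ := fun e => if e ∈ (A.pos P).R then A.w e else 0
    have hwR : ∀ e ∈ (A.pos P).R, w e = A.w e := fun e he => if_pos he
    have hwG : ∀ e ∉ (A.pos P).R, w e = 0 := fun e he => if_neg he
    have hw : ∀ e, 0 ≤ w e := fun e => by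
      by_cases he : e ∈ (A.pos P).R
      · rw [hwR e he]; exact A.w_nonneg e (hRR he)
      · rw [hwG e he]
    have hsub : ∀ F₁, ∀ e ∈ (A.pos (P ++ [⟨B, F₁⟩])).R, w e = A.w e := fun F₁ e he => by
      rw [pos_append] at he
      exact hwR e (Finset.sdiff_subset he)
    have hcost : ∀ F₁, A.Legal (A.pos P) ⟨B, F₁⟩ → A.totalCost (P ++ [⟨B, F₁⟩]) -
        ∑ e ∈ (A.pos (P ++ [⟨B, F₁⟩])).G, w e =
        A.totalCost P - ∑ e ∈ (A.pos P).G, w e + ∑ e ∈ B, w e := fun F₁ h => by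
      have h1 : A.weight F₁ = ∑ e ∈ F₁, w e :=
        Finset.sum_congr rfl fun e he => (hwR e (h.2.2.1 he)).symm
      rw [totalCost_append, pos_append, sum_next h.2.1 h.2.2.1 hd, h1]
      ring
    refine exists_fixerSuperior (w := w) (H := ((A.pos P).G ∪ (A.pos P).R) \ B) hk hkS hw
      ?_ ?_ ?_ ?_ ?_ ?_ ?_ ?_ hφ' hT
    · rw [htake]; exact hsub F
    · rw [htake']; exact hsub F'
    · rw [htake, pos_append]
      exact isGreedyPosition_next hd hwG hwR hr hf
    · rw [htake]; exact fixerWins_append.2 hf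
    · rw [htake']; exact fixerWins_append.2 hf
    · rw [htake', pos_append]; exact next_union hleg'.2.1 hleg'.2.2.1 hd
    · rw [htake, htake', totalBusted_append, totalBusted_append]
    · rw [htake, htake', hcost F hleg, hcost F' hleg']
  -- Buster has already won: both answers are empty and nothing can follow, so the same series
  -- serves on both sides.
  · obtain rfl : F = ∅ := hleg.2.2.2.2 hf
    obtain rfl : F' = ∅ := hleg'.2.2.2.2 hf
    have hroot := hφ'.root_mem
    have hTpre := hT.2.1
    rw [htake] at hTpre
    rw [htake'] at hroot
    obtain ⟨L, rfl⟩ := hTpre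
    have hL : L = [] := by
      by_contra hL
      have hTs : A.IsSeries (P ++ [⟨B, ∅⟩] ++ L) := hT.1
      exact hf ((hTs.2 P ⟨B, ∅⟩ L (List.append_cons P _ L).symm).2 hL)
    subst hL
    rw [List.append_nil]
    exact ⟨_, hroot, Or.inr (busterWins_append.2 hf), le_rfl, le_rfl⟩

/-- Each further round deletes at least one edge. -/
theorem eq_nil_of_totalBusted_le {P L : List (Round E)} (h : A.IsSeries (P ++ L))
    (hle : A.totalBusted (P ++ L) ≤ A.totalBusted P) : L = [] := by
  rcases L with _ | ⟨q, L⟩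
  · rfl
  · have hq := (h.2 P q L rfl).1.1.card_pos
    simp only [totalBusted, List.map_append, List.sum_append, List.map_cons, List.sum_cons] at hle
    omega

theorem isGreedyMove_of_isOptimalMove {P Q : List (Round E)} {r : Round E}
    (h : A.IsOptimalMove (P ++ r :: Q) (P.length + 1)) :
    A.IsGreedyMove (P ++ r :: Q) (P.length + 1) := by
  obtain ⟨φ, hφ, hopt⟩ := h
  intro S' F F' hS' hsame
  have hlenS' : P.length + 1 ≤ S'.length := by
    obtain ⟨P', B, Q', Q'', hP', -, rfl⟩ := hsame
    simp [← hP']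
  -- The series tested is the root of `φ`, where play stops after this round. The greedy strategy
  -- merely supplies some strategy after the rival answer.
  obtain ⟨T, hT, -, hb, hc⟩ := hopt S' F F' hS' hsame _
    (isFixerStrategy_greedyStrategy hS' (by omega) hlenS') _ hφ.root_mem
  obtain ⟨P', B, Q', Q'', hP', h1, rfl⟩ := hsame
  obtain ⟨rfl, h2⟩ := List.append_inj h1 (by omega)
  obtain ⟨rfl, rfl⟩ := List.cons_eq_cons.1 h2
  obtain ⟨hTs, ⟨L, rfl⟩, -⟩ := hT
  rw [take_append_cons] at hb hc hTs
  rw [take_append_cons] at hb hc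
  have hL : L = [] := eq_nil_of_totalBusted_le hTs <| by
    rw [totalBusted_append] at hb ⊢
    exact hb
  subst hL
  rw [List.append_nil, totalCost_append, totalCost_append] at hc
  simpa using hc

end Arena

theorem theorem1p1 {V E : Type*} [Finite V] [DecidableEq E] (A : Arena V E)
    (S : List (Round E)) (hS : A.IsSeries S) (k : ℕ) (hk : 1 ≤ k) (hkS : k ≤ S.length) :
    A.IsGreedyMove S k ↔ A.IsOptimalMove S k := by
  obtain ⟨m, rfl⟩ : ∃ m, k = m + 1 := ⟨k - 1, by omega⟩
  have hsplit : S = S.take m ++ S[m] :: S.drop (m + 1) := by simp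
  have hlen : (S.take m).length = m := by
    rw [List.length_take]
    omega
  generalize S.take m = P at hsplit hlen
  generalize S[m] = r at hsplit
  generalize S.drop (m + 1) = Q at hsplit
  subst hsplit hlen
  exact ⟨fun h => Arena.isOptimalMove_of_isCheapest hS ((Arena.isGreedyMove_iff hS).1 h),
    Arena.isGreedyMove_of_isOptimalMove⟩
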